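/- Let $n\ge 0$, $N=2^n$, and let $\sigma$ be a uniformly random permutation of $\{0,1\}^n$. The Even--Mansour cipher is $EM(m)=k_2\oplus\sigma(k_1\oplus m)$, with $(k_1,k_2)$ uniform in $(\{0,1\}^n)^2$ and independent of $\sigma$. Consider key-recovery adversaries that may query the public permutation ($\sigma$ and $\sigma^{-1}$) and the encryption oracle $EM$, but not the decryption oracle. A non-adaptive $(S,T)$-adversary with preprocessing is a pair $A=(A_0,A_1)$: the unbounded algorithm $A_0$ sees the whole of $\sigma$ (but not the key) and outputs an advice string $z$ of at most $S$ bits; the online algorithm $A_1$ receives $z$, makes at most $T$ oracle queries, all fixed by $z$, and outputs a guess of $(k_1,k_2)$ computed from $z$ and the answers. ($A_0$ and $A_1$ may also share random coins that are independent of $\sigma$ and of the key.) The success probability of $A$ is the probability that the guess equals $(k_1,k_2)$. Let $\mathbf{MaxS}_{EM}(T)$ be the optimal success probability of a non-adaptive adversary of the same kind without preprocessing, that is, one that receives no advice and makes at most $T$ queries, fixed in advance. Then the success probability of every non-adaptive $(S,T)$-adversary with preprocessing is at most $$2\,\mathbf{MaxS}_{EM}(T)+\frac{4\ln 2\cdot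 S(T+1)}{N}+\frac{T^2}{N},$$ and, if $T\ge 1$, this quantity is at most $$\frac{3T^2}{N}+\frac{4\ln 2\cdot S(T+1)}{N}.$$ The same two statements hold for the single-key variant, in which $k_1=k_2$ is uniform in $\{0,1\}^n$ and the adversary has to output this key (with $\mathbf{MaxS}_{EM}(T)$ defined for that variant). -/

import Mathlib

namespace EM

/-- Plaintexts, ciphertexts and keys: bit strings of length `n`; `^^^` is the bitwise XOR.
There are `N = 2 ^ n` of them. -/
abbrev Block (n : ℕ) : Type := BitVec n

/-- Even-Mansour encryption `m ↦ k₂ ⊕ σ (k₁ ⊕ m)`; here `k = (k₁, k₂)`. -/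
def encrypt {n : ℕ} (σ : Equiv.Perm (Block n)) (k : Block n × Block n) (m : Block n) : Block n :=
  k.2 ^^^ σ (k.1 ^^^ m)

/-- Key schedule of the two-key cipher: the secret is the pair `(k₁, k₂)` itself. -/
def twoKey (n : ℕ) (k : Block n × Block n) : Block n × Block n := k

/-- Key schedule of the single-key cipher: the secret is one block `k₁`, and `k₂ = k₁`. -/
def oneKey (n : ℕ) (k : Block n) : Block n × Block n := (k, k)

/-- The oracle queries: the public permutation, its inverse, and encryption
(there are no decryption queries). -/
inductive Query (n : ℕ) : Type
  | pub (x : Block n)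
  | pubInv (y : Block n)
  | enc (m : Block n)

/-- The oracle's answer to a query. -/
def answer {n : ℕ} (σ : Equiv.Perm (Block n)) (k : Block n × Block n) : Query n → Block n
  | Query.pub x => σ x
  | Query.pubInv y => σ.symm y
  | Query.enc m => encrypt σ k m

/-- A non-adaptive attack without preprocessing: a list of queries that is fixed in advance,
and an arbitrary function that computes a guess of the secret (in `K`) from the answers. -/
structure Attack (n : ℕ) (K : Type) where
  queries : List (Query n)
  output : List (Block n) → K

/-- The output of the attack when the permutation is `σ` and the cipher uses the key pair `k`. -/
def Attack.run {n : ℕ} {K : Type} (B : Attack n K) (σ : Equiv.Perm (Block n))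
    (k : Block n × Block n) : K :=
  B.output (B.queries.map (answer σ k))

/-- A non-adaptive attack with preprocessing: `advice` sees the whole permutation and outputs a
bit string `z`; the online algorithm `online z` is non-adaptive, so that its queries depend on
`z` only, and its output on `z` and on the answers. -/
structure PreAttack (n : ℕ) (K : Type) where
  advice : Equiv.Perm (Block n) → List Bool
  online : List Bool → Attack n K

/-- The attack uses at most `S` bits of advice and at most `T` queries, whatever `σ` is. -/
def PreAttack.IsST {n : ℕ} {K : Type} (A : PreAttack n K) (S T : ℕ) : Prop :=
  ∀ σ : Equiv.Perm (Block n),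
    (A.advice σ).length ≤ S ∧ (A.online (A.advice σ)).queries.length ≤ T

section Success

variable {n : ℕ} {K : Type} [Fintype K] [DecidableEq K]

/-- Success probability of a preprocessing attack: the probability, over a uniform permutation
and a uniform independent secret, that the output is the secret. `κ` is the key schedule. -/
noncomputable def PreAttack.success (κ : K → Block n × Block n) (A : PreAttack n K) : ℝ :=
  ((Finset.univ.filter fun p : Equiv.Perm (Block n) × K =>
      (A.online (A.advice p.1)).run p.1 (κ p.2) = p.2).card : ℝ)
    / (Fintype.card (Equiv.Perm (Block n) × K) : ℝ)

/-- Success probability of an attack without preprocessing, over a uniform permutation and a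
uniform independent secret. -/
noncomputable def Attack.success (κ : K → Block n × Block n) (B : Attack n K) : ℝ :=
  ((Finset.univ.filter fun p : Equiv.Perm (Block n) × K =>
      B.run p.1 (κ p.2) = p.2).card : ℝ)
    / (Fintype.card (Equiv.Perm (Block n) × K) : ℝ)

/-- The optimal success probability of a non-adaptive attack without preprocessing that makes at
most `T` queries (random coins would not change the supremum). -/
noncomputable def maxSuccess (κ : K → Block n × Block n) (T : ℕ) : ℝ :=
  sSup {p : ℝ | ∃ B : Attack n K, B.queries.length ≤ T ∧ p = B.success κ}

/-- Success probability of a randomized preprocessing attack whose two phases share random coins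
`r` drawn from `ρ`, independently of the permutation and of the secret. -/
noncomputable def randSuccess {R : Type*} (ρ : PMF R) (κ : K → Block n × Block n)
    (A : R → PreAttack n K) : ℝ :=
  ∑' r, (ρ r).toReal * (A r).success κ

end Success

end EM

/-! Fix one non-adaptive attack with `t` revealed points of `σ` and `e` queried plaintexts, `t + e ≤
T`, and condition on the public answers: the rest of `σ` is then a uniform permutation `ρ` of the
unrevealed points. At most `t * e` first keys `a` make an encryption query hit a revealed point;
these are conceded. For every other `a`, the fraction of recovered secrets with first key `a` lies
in `[0, 1]` and depends on `ρ` only at the `e` points `a ⊕ m`. Each point is used by at most `e`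
first keys, so these fractions are weakly dependent. A list of ciphertexts determines the guess,
which bounds the sum of their means by a ratio of falling factorials (`sum_freshHits_le`).

Weak dependence is exploited through a Finner inequality on the symmetric group
(`log_avg_exp_sum_le`): the exponential moment of the sum, scaled by `c = 2 * (T + 1)`, is at most
the product of the individual exponential moments to the power `1 / c`. The 2 is there because a
transposition moves two points. The inequality is dual to a superadditivity of relative entropy
(`sum_unifEntropy_cosetAvg_le`), which is proved by a minimisation: averaging a distribution with
its translate by a transposition does not increase the entropy defect, and the uniform distribution
has defect zero.

The resulting moment bound (`sum_exp_hits_le`) is summed over the at most `4 ^ S` advice strings,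
and Jensen's inequality turns it into a bound on the mean number of recovered secrets. A remaining
`2 / |K|` is paid for by the attack that makes no query and guesses a constant. -/

/-! ### Entropy loss when two masses are averaged -/

/-- The entropy that is lost when two masses `a`, `b` are replaced by their mean. -/
noncomputable def mixGap (a b : ℝ) : ℝ :=
  a * Real.log (a / (a + b)) + b * Real.log (b / (a + b)) + (a + b) * Real.log 2

lemma mixGap_self {a : ℝ} : mixGap a a = 0 := by
  unfold mixGap
  rcases eq_or_ne a 0 with rfl | ha
  · simp
  · have : a / (a + a) = 2⁻¹ := by field_simp; norm_num
    rw [this, Real.log_inv]; ring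

lemma mixGap_eq {a b : ℝ} (ha : 0 ≤ a) (hb : 0 ≤ b) :
    a * Real.log a + b * Real.log b - 2 * ((a + b) / 2 * Real.log ((a + b) / 2)) = mixGap a b := by
  unfold mixGap
  rcases eq_or_lt_of_le (add_nonneg ha hb) with h | h
  · have h1 : a = 0 := by linarith
    have h2 : b = 0 := by linarith
    simp [h1, h2]
  · have key : ∀ x : ℝ, x * Real.log (x / (a + b)) = x * Real.log x - x * Real.log (a + b) := by
      intro x
      rcases eq_or_ne x 0 with rfl | hx
      · simp
      · rw [Real.log_div hx h.ne']; ring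
    rw [key, key, Real.log_div h.ne' two_ne_zero]
    ring

/-- The two-term log-sum inequality. -/
lemma log_sum_two {a a' s s' : ℝ} (ha : 0 ≤ a) (ha' : 0 ≤ a') (has : a ≤ s) (has' : a' ≤ s') :
    (a + a') * Real.log ((a + a') / (s + s')) ≤
      a * Real.log (a / s) + a' * Real.log (a' / s') := by
  rcases eq_or_lt_of_le (ha.trans has) with h | h
  · have : a = 0 := by linarith
    simp [this, ← h]
  rcases eq_or_lt_of_le (ha'.trans has') with h' | h'
  · have : a' = 0 := by linarith
    simp [this, ← h']
  have hS : 0 < s + s' := by linarith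
  have hx : a / s ∈ Set.Ici (0 : ℝ) := Set.mem_Ici.2 (by positivity)
  have hy : a' / s' ∈ Set.Ici (0 : ℝ) := Set.mem_Ici.2 (by positivity)
  have hw : 0 ≤ s / (s + s') := by positivity
  have hw' : 0 ≤ s' / (s + s') := by positivity
  have := Real.convexOn_mul_log.2 hx hy hw hw' (by field_simp)
  simp only [smul_eq_mul] at this
  have e : s / (s + s') * (a / s) + s' / (s + s') * (a' / s') = (a + a') / (s + s') := by
    field_simp
  rw [e] at this
  have := mul_le_mul_of_nonneg_left this hS.le
  calc _ = (s + s') * ((a + a') / (s + s') * Real.log ((a + a') / (s + s'))) := by field_simp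
    _ ≤ _ := this
    _ = _ := by field_simp

/-- Each of the two logarithmic terms is subadditive by the log-sum inequality, and the last term is
linear. Together with `mixGap_mul` this is what makes the gap shrink under coset averages. -/
lemma mixGap_add_le {a a' b b' : ℝ} (ha : 0 ≤ a) (ha' : 0 ≤ a') (hb : 0 ≤ b) (hb' : 0 ≤ b') :
    mixGap (a + a') (b + b') ≤ mixGap a b + mixGap a' b' := by
  have h1 := log_sum_two ha ha' (le_add_of_nonneg_right hb) (le_add_of_nonneg_right hb')
  have h2 := log_sum_two hb hb' (le_add_of_nonneg_left ha) (le_add_of_nonneg_left ha')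
  have e : a + a' + (b + b') = a + b + (a' + b') := by ring
  unfold mixGap
  rw [e]
  linarith

lemma mixGap_sum_le {α : Type*} (s : Finset α) {a b : α → ℝ} (ha : ∀ i, 0 ≤ a i)
    (hb : ∀ i, 0 ≤ b i) :
    mixGap (∑ i ∈ s, a i) (∑ i ∈ s, b i) ≤ ∑ i ∈ s, mixGap (a i) (b i) := by
  classical
  induction s using Finset.induction_on with
  | empty => simp [mixGap]
  | insert i s hi ih =>
    rw [Finset.sum_insert hi, Finset.sum_insert hi, Finset.sum_insert hi]
    exact (mixGap_add_le (ha i) (Finset.sum_nonneg fun j _ => ha j) (hb i)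
      (Finset.sum_nonneg fun j _ => hb j)).trans (by linarith)

lemma mixGap_mul {c a b : ℝ} (hc : c ≠ 0) : mixGap (c * a) (c * b) = c * mixGap a b := by
  unfold mixGap
  rw [← mul_add, mul_div_mul_left _ _ hc, mul_div_mul_left _ _ hc]
  ring

lemma mixGap_nonneg {a b : ℝ} (ha : 0 ≤ a) (hb : 0 ≤ b) : 0 ≤ mixGap a b := by
  -- Adding the swapped pair gives equal masses, whose gap is zero; by symmetry twice the gap is
  -- nonnegative.
  have := mixGap_add_le ha hb hb ha
  have e : mixGap b a = mixGap a b := by unfold mixGap; rw [add_comm b a]; ring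
  rw [add_comm b a, mixGap_self, e] at this
  linarith

/-! ### Superadditivity of entropy and a Finner inequality on a finite group -/

section Group

variable {G : Type*} [Group G] [Fintype G]

/-- The average of `P` over the left cosets of `H`. -/
noncomputable def cosetAvg (H : Subgroup G) (P : G → ℝ) (x : G) : ℝ :=
  (Nat.card H : ℝ)⁻¹ * ∑ᶠ g : H, P (x * g)

open Classical in
lemma cosetAvg_eq (H : Subgroup G) (P : G → ℝ) (x : G) :
    cosetAvg H P x = (Nat.card H : ℝ)⁻¹ * ∑ g : H, P (x * g) := by
  rw [cosetAvg, finsum_eq_sum_of_fintype]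

lemma card_subgroup_pos (H : Subgroup G) : (0 : ℝ) < Nat.card H := by
  exact_mod_cast Nat.card_pos

lemma cosetAvg_nonneg {H : Subgroup G} {P : G → ℝ} (hP : ∀ x, 0 ≤ P x) (x : G) :
    0 ≤ cosetAvg H P x := by
  classical
  rw [cosetAvg_eq]
  exact mul_nonneg (by positivity) (Finset.sum_nonneg fun g _ => hP _)

lemma cosetAvg_pos {H : Subgroup G} {P : G → ℝ} (hP : ∀ x, 0 < P x) (x : G) :
    0 < cosetAvg H P x := by
  classical
  rw [cosetAvg_eq]
  exact mul_pos (inv_pos.2 (card_subgroup_pos H))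
    (Finset.sum_pos (fun g _ => hP _) ⟨1, Finset.mem_univ _⟩)

lemma cosetAvg_mul_mem {H : Subgroup G} (P : G → ℝ) (x : G) {h : G} (hh : h ∈ H) :
    cosetAvg H P (x * h) = cosetAvg H P x := by
  classical
  rw [cosetAvg_eq, cosetAvg_eq]
  congr 1
  exact Fintype.sum_equiv (Equiv.mulLeft (⟨h, hh⟩ : H)) _ _ fun g => by simp [mul_assoc]

/-- Functions constant on the left cosets of `H` cannot tell `P` from its coset average. -/
lemma sum_mul_cosetAvg {H : Subgroup G} (P F : G → ℝ) (hF : ∀ x, ∀ h ∈ H, F (x * h) = F x) :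
    ∑ x, F x * cosetAvg H P x = ∑ x, F x * P x := by
  classical
  have hc := card_subgroup_pos H
  calc ∑ x, F x * cosetAvg H P x
      = (Nat.card H : ℝ)⁻¹ * ∑ g : H, ∑ x, F x * P (x * g) := by
        rw [Finset.sum_comm, Finset.mul_sum]
        refine Finset.sum_congr rfl fun x _ => ?_
        rw [cosetAvg_eq, ← Finset.mul_sum]; ring
    _ = (Nat.card H : ℝ)⁻¹ * ∑ g : H, ∑ x, F x * P x := by
        congr 1
        refine Finset.sum_congr rfl fun g _ => ?_
        exact Fintype.sum_equiv (Equiv.mulRight (g : G)) _ _ fun x => by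
          simp [hF x g g.2]
    _ = _ := by
        rw [Finset.sum_const, Finset.card_univ, ← Nat.card_eq_fintype_card, nsmul_eq_mul,
          inv_mul_cancel_left₀ hc.ne']

lemma sum_cosetAvg {H : Subgroup G} (P : G → ℝ) : ∑ x, cosetAvg H P x = ∑ x, P x := by
  simpa using sum_mul_cosetAvg (H := H) P (fun _ => 1) (fun _ _ _ => rfl)

/-- The relative entropy of `P` with respect to the uniform distribution. -/
noncomputable def unifEntropy (P : G → ℝ) : ℝ :=
  ∑ x, P x * Real.log (P x) + (∑ x, P x) * Real.log (Fintype.card G)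

/-- Averaging `P` with its translate by `τ`. -/
noncomputable def mixBy (τ : G) (P : G → ℝ) (x : G) : ℝ := (P x + P (τ * x)) / 2

lemma sum_mixBy (τ : G) (P : G → ℝ) : ∑ x, mixBy τ P x = ∑ x, P x := by
  have : ∑ x, P (τ * x) = ∑ x, P x := Fintype.sum_equiv (Equiv.mulLeft τ) _ _ fun x => rfl
  simp only [mixBy]
  rw [← Finset.sum_div, Finset.sum_add_distrib, this]
  ring

lemma cosetAvg_mixBy (H : Subgroup G) (τ : G) (P : G → ℝ) :
    cosetAvg H (mixBy τ P) = mixBy τ (cosetAvg H P) := by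
  classical
  funext x
  simp only [mixBy, cosetAvg_eq, mul_assoc]
  rw [← Finset.sum_div, Finset.sum_add_distrib]
  ring

lemma unifEntropy_sub_mixBy {P : G → ℝ} (hP : ∀ x, 0 ≤ P x) (τ : G) :
    unifEntropy P - unifEntropy (mixBy τ P) = (∑ x, mixGap (P x) (P (τ * x))) / 2 := by
  have h1 : ∑ x, P (τ * x) * Real.log (P (τ * x)) = ∑ x, P x * Real.log (P x) :=
    Fintype.sum_equiv (Equiv.mulLeft τ) _ _ fun x => rfl
  have h2 : ∑ x, mixGap (P x) (P (τ * x)) =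
      ∑ x, P x * Real.log (P x) + ∑ x, P (τ * x) * Real.log (P (τ * x))
        - 2 * ∑ x, mixBy τ P x * Real.log (mixBy τ P x) := by
    rw [Finset.mul_sum, ← Finset.sum_add_distrib, ← Finset.sum_sub_distrib]
    exact Finset.sum_congr rfl fun x _ => (mixGap_eq (hP _) (hP _)).symm
  unfold unifEntropy
  rw [h2, h1, sum_mixBy]
  ring

-- If `x⁻¹ * τ * x ∈ H`, then `x` and `τ * x` lie in the same left coset and the averaged function
-- has no gap there. Otherwise homogeneity and subadditivity of `mixGap` bound the gap of the
-- averages by the average gap; since the condition depends only on the coset of `x`, that average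
-- can be undone after summation.
open Classical in
lemma sum_mixGap_cosetAvg_le {P : G → ℝ} (hP : ∀ x, 0 ≤ P x) (H : Subgroup G) (τ : G) :
    ∑ x, mixGap (cosetAvg H P x) (cosetAvg H P (τ * x)) ≤
      ∑ x, if x⁻¹ * τ * x ∈ H then 0 else mixGap (P x) (P (τ * x)) := by
  have hc := card_subgroup_pos H
  set F : G → ℝ := fun x => if x⁻¹ * τ * x ∈ H then 0 else 1 with hF
  have hFinv : ∀ x, ∀ h ∈ H, F (x * h) = F x := by
    intro x h hh
    have : (x * h)⁻¹ * τ * (x * h) = h⁻¹ * (x⁻¹ * τ * x) * h := by group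
    simp only [hF, this, H.mul_mem_cancel_right hh, H.mul_mem_cancel_left (H.inv_mem hh)]
  have h2 : ∑ x, (if x⁻¹ * τ * x ∈ H then 0 else mixGap (P x) (P (τ * x))) =
      ∑ x, F x * mixGap (P x) (P (τ * x)) := by
    refine Finset.sum_congr rfl fun x _ => ?_
    simp only [hF]; split_ifs <;> simp
  rw [h2, ← sum_mul_cosetAvg _ F hFinv]
  refine Finset.sum_le_sum fun x _ => ?_
  by_cases hx : x⁻¹ * τ * x ∈ H
  · have e : τ * x = x * (x⁻¹ * τ * x) := by group
    rw [e, cosetAvg_mul_mem P x hx, mixGap_self]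
    simp [hF, hx]
  · simp only [hF, hx, if_false, one_mul]
    rw [cosetAvg_eq, cosetAvg_eq, cosetAvg_eq, mixGap_mul (inv_ne_zero hc.ne')]
    refine mul_le_mul_of_nonneg_left ?_ (by positivity)
    refine (mixGap_sum_le _ (fun _ => hP _) fun _ => hP _).trans (le_of_eq ?_)
    simp [mul_assoc]

variable {ι : Type*} [Fintype ι]

/-- The defect in the superadditivity of entropy. -/
noncomputable def entropyDefect (c : ℝ) (H : ι → Subgroup G) (P : G → ℝ) : ℝ :=
  c * unifEntropy P - ∑ k, unifEntropy (cosetAvg (H k) P)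

-- Both entropy drops are sums of `mixGap` over `x`. The gap at `x` enters the drop of the `k`-th
-- average only when `x⁻¹ * τ * x ∉ H k`, hence for at most `c` indices, so `c` times the drop for
-- `P` pays for all of them.
open Classical in
lemma entropyDefect_mixBy_le {c : ℝ} {H : ι → Subgroup G} {τ : G}
    (hτ : ∀ x, ((Finset.univ.filter fun k => x⁻¹ * τ * x ∉ H k).card : ℝ) ≤ c)
    {P : G → ℝ} (hP : ∀ x, 0 ≤ P x) :
    entropyDefect c H (mixBy τ P) ≤ entropyDefect c H P := by
  have h1 : ∑ k, (unifEntropy (cosetAvg (H k) P) - unifEntropy (cosetAvg (H k) (mixBy τ P))) ≤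
      c * (unifEntropy P - unifEntropy (mixBy τ P)) := by
    calc _ ≤ ∑ k, (∑ x, if x⁻¹ * τ * x ∈ H k then 0 else mixGap (P x) (P (τ * x))) / 2 := by
          refine Finset.sum_le_sum fun k _ => ?_
          rw [cosetAvg_mixBy, unifEntropy_sub_mixBy (cosetAvg_nonneg hP)]
          exact div_le_div_of_nonneg_right (sum_mixGap_cosetAvg_le hP _ _) (by norm_num)
      _ = (∑ x, ((Finset.univ.filter fun k => x⁻¹ * τ * x ∉ H k).card : ℝ) *
            mixGap (P x) (P (τ * x))) / 2 := by
          rw [← Finset.sum_div, Finset.sum_comm]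
          congr 1
          refine Finset.sum_congr rfl fun x _ => ?_
          rw [← nsmul_eq_mul, ← Finset.sum_const, Finset.sum_filter]
          exact Finset.sum_congr rfl fun k _ => by split_ifs <;> simp_all
      _ ≤ (∑ x, c * mixGap (P x) (P (τ * x))) / 2 := by
          gcongr with x
          · exact mixGap_nonneg (hP _) (hP _)
          · exact hτ x
      _ = _ := by rw [unifEntropy_sub_mixBy hP, ← Finset.mul_sum]; ring
  rw [Finset.sum_sub_distrib] at h1
  unfold entropyDefect
  linarith

omit [Group G] in
lemma continuous_unifEntropy : Continuous (unifEntropy : (G → ℝ) → ℝ) := by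
  unfold unifEntropy
  refine Continuous.add (continuous_finsetSum _ fun x _ => ?_) (by fun_prop)
  exact Real.continuous_mul_log.comp (continuous_apply x)

lemma continuous_entropyDefect (c : ℝ) (H : ι → Subgroup G) :
    Continuous (entropyDefect c H) := by
  classical
  refine Continuous.sub (continuous_const.mul continuous_unifEntropy)
    (continuous_finsetSum _ fun k _ => continuous_unifEntropy.comp ?_)
  refine continuous_pi fun x => ?_
  simp only [cosetAvg_eq]
  fun_prop

/-- The parallelogram identity: mixing strictly decreases the sum of squares unless `P` is already
invariant under `τ`. -/
lemma sum_sq_mixBy {τ : G} (P : G → ℝ) :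
    ∑ x, mixBy τ P x ^ 2 = ∑ x, P x ^ 2 - (∑ x, (P x - P (τ * x)) ^ 2) / 4 := by
  have h : ∑ x, P (τ * x) ^ 2 = ∑ x, P x ^ 2 :=
    Fintype.sum_equiv (Equiv.mulLeft τ) _ _ fun x => rfl
  have : ∑ x, mixBy τ P x ^ 2 + (∑ x, (P x - P (τ * x)) ^ 2) / 4 =
      (∑ x, P x ^ 2 + ∑ x, P (τ * x) ^ 2) / 2 := by
    rw [Finset.sum_div, ← Finset.sum_add_distrib, ← Finset.sum_add_distrib, Finset.sum_div]
    exact Finset.sum_congr rfl fun x _ => by unfold mixBy; ring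
  rw [h] at this
  linarith

lemma unifEntropy_uniform : unifEntropy (fun _ : G => (Fintype.card G : ℝ)⁻¹) = 0 := by
  have : (Fintype.card G : ℝ) ≠ 0 := by simp
  unfold unifEntropy
  simp [Finset.card_univ, Real.log_inv]

lemma cosetAvg_const (H : Subgroup G) (a : ℝ) : cosetAvg H (fun _ => a) = fun _ => a := by
  classical
  funext x
  have hc := card_subgroup_pos H
  rw [cosetAvg_eq, Finset.sum_const, Finset.card_univ, ← Nat.card_eq_fintype_card, nsmul_eq_mul,
    inv_mul_cancel_left₀ hc.ne']

open Classical in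
/-- Superadditivity of relative entropy for a family of coset averages in a group. -/
theorem sum_unifEntropy_cosetAvg_le {c : ℝ} {H : ι → Subgroup G} {𝒯 : Set G}
    (hgen : Subgroup.closure 𝒯 = ⊤)
    (h𝒯 : ∀ τ ∈ 𝒯, ∀ x, ((Finset.univ.filter fun k => x⁻¹ * τ * x ∉ H k).card : ℝ) ≤ c)
    {P : G → ℝ} (hP : P ∈ stdSimplex ℝ G) :
    ∑ k, unifEntropy (cosetAvg (H k) P) ≤ c * unifEntropy P := by
  -- A minimiser of the defect alone need not be invariant, so the strictly convex penalty `ε * ∑ P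
  -- ^ 2` is added and `ε` is sent to zero.
  suffices h : ∀ ε : ℝ, 0 < ε → -ε * ∑ x, P x ^ 2 ≤ entropyDefect c H P by
    have h0 : 0 ≤ entropyDefect c H P := by
      by_contra! hneg
      have hs : 0 ≤ ∑ x, P x ^ 2 := Finset.sum_nonneg fun x _ => sq_nonneg _
      have := h (-entropyDefect c H P / (2 * (∑ x, P x ^ 2 + 1))) (by
        apply div_pos <;> linarith)
      have h2 : -entropyDefect c H P / (2 * (∑ x, P x ^ 2 + 1)) * ∑ x, P x ^ 2 ≤
          -entropyDefect c H P / 2 := by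
        rw [div_mul_eq_mul_div, div_le_div_iff₀ (by linarith) (by norm_num)]
        nlinarith
      linarith
    unfold entropyDefect at h0
    linarith
  intro ε hε
  have hcont : Continuous fun P : G → ℝ => entropyDefect c H P + ε * ∑ x, P x ^ 2 :=
    (continuous_entropyDefect c H).add (by fun_prop)
  obtain ⟨Q, hQ, hmin⟩ := (isCompact_stdSimplex ℝ G).exists_isMinOn ⟨P, hP⟩ hcont.continuousOn
  have hinv : ∀ τ ∈ 𝒯, ∀ x, Q (τ * x) = Q x := by
    intro τ hτ
    have hmem : mixBy τ Q ∈ stdSimplex ℝ G :=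
      ⟨fun x => div_nonneg (add_nonneg (hQ.1 _) (hQ.1 _)) (by norm_num),
        (sum_mixBy τ Q).trans hQ.2⟩
    have h1 := hmin hmem
    simp only [Set.mem_ofPred_eq] at h1
    have h2 := entropyDefect_mixBy_le (h𝒯 τ hτ) hQ.1
    rw [sum_sq_mixBy] at h1
    have h3 : ∑ x, (Q x - Q (τ * x)) ^ 2 ≤ 0 := by
      by_contra! hpos
      nlinarith
    have h4 := (Finset.sum_eq_zero_iff_of_nonneg fun x _ => sq_nonneg (Q x - Q (τ * x))).1
      (le_antisymm h3 (Finset.sum_nonneg fun x _ => sq_nonneg _))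
    intro x
    have := pow_eq_zero_iff (two_ne_zero) |>.1 (h4 x (Finset.mem_univ _))
    linarith
  have hinv' : ∀ g : G, ∀ x, Q (g * x) = Q x := by
    intro g
    have hg : g ∈ Subgroup.closure 𝒯 := hgen ▸ Subgroup.mem_top g
    induction hg using Subgroup.closure_induction with
    | mem τ hτ => exact hinv τ hτ
    | one => simp
    | mul a b _ _ iha ihb => intro x; rw [mul_assoc, iha, ihb]
    | inv a _ iha => intro x; rw [← iha, mul_inv_cancel_left]
  have hconst : Q = fun _ => (Fintype.card G : ℝ)⁻¹ := by
    have h1 : ∀ x, Q x = Q 1 := fun x => by simpa using hinv' x 1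
    have h2 := hQ.2
    simp only [h1, Finset.sum_const, Finset.card_univ, nsmul_eq_mul] at h2
    funext x
    rw [h1]
    exact eq_inv_of_mul_eq_one_right h2
  have hz : entropyDefect c H Q = 0 := by
    unfold entropyDefect
    rw [hconst]
    simp [cosetAvg_const, unifEntropy_uniform]
  have h1 := hmin hP
  simp only [Set.mem_ofPred_eq] at h1
  have : 0 ≤ ∑ x, Q x ^ 2 := Finset.sum_nonneg fun x _ => sq_nonneg _
  nlinarith

open Classical in
/-- A Finner-type inequality for functions that are constant on cosets of subgroups. -/
theorem log_avg_exp_sum_le {c : ℝ} (hc : 0 < c) {H : ι → Subgroup G} {𝒯 : Set G}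
    (hgen : Subgroup.closure 𝒯 = ⊤)
    (h𝒯 : ∀ τ ∈ 𝒯, ∀ x, ((Finset.univ.filter fun k => x⁻¹ * τ * x ∉ H k).card : ℝ) ≤ c)
    (h : ι → G → ℝ) (hh : ∀ k x, ∀ g ∈ H k, h k (x * g) = h k x) :
    c * Real.log ((∑ x, Real.exp ((∑ k, h k x) / c)) / Fintype.card G) ≤
      ∑ k, Real.log ((∑ x, Real.exp (h k x)) / Fintype.card G) := by
  set Z : ℝ := ∑ x, Real.exp ((∑ k, h k x) / c) with hZdef
  have hZ : 0 < Z := Finset.sum_pos (fun x _ => Real.exp_pos _) ⟨1, Finset.mem_univ _⟩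
  have hG : (0 : ℝ) < Fintype.card G := by exact_mod_cast Fintype.card_pos
  -- The Gibbs distribution, for which the variational formula for the logarithm of the left-hand
  -- average is an equality; superadditivity is applied to it.
  set P : G → ℝ := fun x => Real.exp ((∑ k, h k x) / c) / Z with hPdef
  have hPpos : ∀ x, 0 < P x := fun x => div_pos (Real.exp_pos _) hZ
  have hPsum : ∑ x, P x = 1 := by
    simp only [hPdef]; rw [← Finset.sum_div, ← hZdef, div_self hZ.ne']
  have hsup := sum_unifEntropy_cosetAvg_le hgen h𝒯 (P := P) ⟨fun x => (hPpos x).le, hPsum⟩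
  have hent : c * unifEntropy P = ∑ k, ∑ x, h k x * P x - c * Real.log (Z / Fintype.card G) := by
    have : ∀ x, P x * Real.log (P x) = (∑ k, h k x * P x) / c - P x * Real.log Z := by
      intro x
      simp only [hPdef]
      rw [Real.log_div (Real.exp_pos _).ne' hZ.ne', Real.log_exp, ← Finset.sum_mul]
      field_simp
    unfold unifEntropy
    simp only [this]
    rw [Finset.sum_sub_distrib, ← Finset.sum_div, ← Finset.sum_mul, hPsum, Finset.sum_comm,
      Real.log_div hZ.ne' hG.ne']
    field_simp
    ring
  -- The variational inequality for a single `h k`: invariance allows `P` to be replaced by its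
  -- coset average, and Jensen's inequality for the logarithm does the rest.
  have hjen : ∀ k, ∑ x, h k x * P x - unifEntropy (cosetAvg (H k) P) ≤
      Real.log ((∑ x, Real.exp (h k x)) / Fintype.card G) := by
    intro k
    have hpos := cosetAvg_pos (H := H k) hPpos
    have hsum : ∑ x, cosetAvg (H k) P x = 1 := (sum_cosetAvg P).trans hPsum
    have := strictConcaveOn_log_Ioi.concaveOn.le_map_sum (t := Finset.univ)
      (w := fun x => cosetAvg (H k) P x)
      (p := fun x => Real.exp (h k x) / (cosetAvg (H k) P x * Fintype.card G))
      (fun x _ => (hpos x).le) hsum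
      (fun x _ => Set.mem_Ioi.2 (div_pos (Real.exp_pos _) (mul_pos (hpos x) hG)))
    simp only [smul_eq_mul] at this
    have e1 : ∑ x, cosetAvg (H k) P x *
        (Real.exp (h k x) / (cosetAvg (H k) P x * Fintype.card G)) =
        (∑ x, Real.exp (h k x)) / Fintype.card G := by
      rw [Finset.sum_div]
      exact Finset.sum_congr rfl fun x _ => by have := (hpos x).ne'; field_simp
    have e2 : ∑ x, cosetAvg (H k) P x *
        Real.log (Real.exp (h k x) / (cosetAvg (H k) P x * Fintype.card G)) =
        ∑ x, h k x * P x - unifEntropy (cosetAvg (H k) P) := by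
      rw [← sum_mul_cosetAvg (H := H k) P (h k) (hh k)]
      unfold unifEntropy
      rw [Finset.sum_mul, ← Finset.sum_add_distrib, ← Finset.sum_sub_distrib]
      refine Finset.sum_congr rfl fun x _ => ?_
      rw [Real.log_div (Real.exp_pos _).ne' (mul_pos (hpos x) hG).ne', Real.log_exp,
        Real.log_mul (hpos x).ne' hG.ne']
      ring
    rw [e1, e2] at this
    exact this
  have := Finset.sum_le_sum fun k (_ : k ∈ Finset.univ) => hjen k
  rw [Finset.sum_sub_distrib] at this
  linarith

end Group

/-! ### Conditioning on part of a permutation, and falling factorials -/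

section Counting

open Classical in
lemma card_perm_eqOn_le {V : Type*} [Fintype V] (A : Finset V) (f : Equiv.Perm V) :
    (Finset.univ.filter fun ρ : Equiv.Perm V => ∀ v ∈ A, ρ v = f v).card ≤
      (Fintype.card V - A.card).factorial := by
  have h1 : (Finset.univ.filter fun ρ : Equiv.Perm V => ∀ v ∈ A, ρ v = f v).card ≤
      (Finset.univ.filter fun g : Equiv.Perm V => ∀ v, ¬ v ∉ A → g v = v).card := by
    refine Finset.card_le_card_of_injOn (fun ρ => f⁻¹ * ρ) ?_ ?_
    · intro ρ hρ
      simp only [Finset.coe_filter, Finset.mem_univ, true_and, Set.mem_ofPred_eq, not_not] at hρ ⊢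
      intro v hv
      simp [hρ v hv]
    · intro ρ _ ρ' _ h
      exact mul_left_cancel h
  refine h1.trans (le_of_eq ?_)
  rw [← Fintype.card_subtype,
    ← Fintype.card_congr (Equiv.Perm.subtypeEquivSubtypePerm fun v => v ∉ A), Fintype.card_perm]
  congr 1
  rw [Fintype.card_subtype_compl, Fintype.card_coe]

open Classical in
/-- To bound an average over all permutations, bound the averages over the permutations that
agree with a given `σ` on a set `D σ` which is itself determined by these values of `σ`. -/
lemma sum_perm_le_of_fiber {X : Type*} [Fintype X] (D : Equiv.Perm X → Finset X)
    (hD : ∀ σ g : Equiv.Perm X, (∀ x ∈ D σ, g x = x) → D (σ * g) = D σ)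
    (F : Equiv.Perm X → ℝ) (b : ℝ)
    (hF : ∀ σ, ∑ ρ : Equiv.Perm {x // x ∉ D σ}, F (σ * Equiv.Perm.ofSubtype ρ) ≤
      b * Fintype.card (Equiv.Perm {x // x ∉ D σ})) :
    ∑ σ, F σ ≤ b * Fintype.card (Equiv.Perm X) := by
  set p : Equiv.Perm X → Equiv.Perm X → Prop := fun σ g => ∀ x, ¬ x ∉ D σ → g x = x with hp
  set C : Equiv.Perm X → ℝ := fun σ => (Fintype.card (Equiv.Perm {x // x ∉ D σ}) : ℝ) with hC
  have hDp : ∀ σ g, p σ g → D (σ * g) = D σ := fun σ g h =>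
    hD σ g fun x hx => h x (not_not.2 hx)
  have hcard : ∀ σ, ((Finset.univ.filter (p σ)).card : ℝ) = C σ := fun σ => by
    simp only [hC]
    rw [← Fintype.card_subtype]
    exact_mod_cast (Fintype.card_congr
      (Equiv.Perm.subtypeEquivSubtypePerm fun x => x ∉ D σ)).symm
  have hCpos : ∀ σ, 0 < C σ := fun σ => by
    simp only [hC]; exact_mod_cast Fintype.card_pos
  have hsum : ∀ σ, ∑ ρ : Equiv.Perm {x // x ∉ D σ}, F (σ * Equiv.Perm.ofSubtype ρ) =
      ∑ g ∈ Finset.univ.filter (p σ), F (σ * g) := fun σ => by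
    rw [← Finset.sum_subtype_eq_sum_filter, Finset.subtype_univ]
    exact Fintype.sum_equiv (Equiv.Perm.subtypeEquivSubtypePerm fun x => x ∉ D σ) _ _
      fun ρ => rfl
  -- The relation between `σ` and `σ * g` is symmetric, since `D` takes the same value at both. This
  -- permits the change of variable `σ ↦ σ * g` after each `F σ` has been spread over its fibre.
  have hiff : ∀ σ g, p σ g ↔ p (σ * g) g := by
    intro σ g
    constructor
    · intro h x hx
      rw [hDp σ g h] at hx
      exact h x hx
    · intro h x hx
      have h' : p (σ * g) g⁻¹ := fun x hx => by
        rw [Equiv.Perm.inv_eq_iff_eq]; exact (h x hx).symm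
      have := hDp _ _ h'
      rw [mul_inv_cancel_right] at this
      rw [this] at hx
      exact h x hx
  calc ∑ σ, F σ = ∑ σ, ∑ g, if p σ g then F σ / C σ else 0 := by
        refine Finset.sum_congr rfl fun σ _ => ?_
        rw [← Finset.sum_filter, Finset.sum_const, nsmul_eq_mul, hcard,
          mul_div_cancel₀ _ (hCpos σ).ne']
    _ = ∑ g, ∑ σ, if p σ g then F σ / C σ else 0 := Finset.sum_comm
    _ = ∑ g, ∑ σ, if p σ g then F (σ * g) / C σ else 0 := by
        refine Finset.sum_congr rfl fun g _ => ?_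
        refine (Fintype.sum_equiv (Equiv.mulRight g) _ _ fun σ => ?_).symm
        have hCσ : p σ g → C (σ * g) = C σ := fun h => by simp only [hC, hDp σ g h]
        change (if p σ g then F (σ * g) / C σ else 0) =
          @ite _ (p (σ * g) g) _ (F (σ * g) / C (σ * g)) 0
        by_cases h : p σ g
        · rw [if_pos h, if_pos ((hiff σ g).1 h), hCσ h]
        · rw [if_neg h, if_neg (mt (hiff σ g).2 h)]
    _ = ∑ σ, (∑ g ∈ Finset.univ.filter (p σ), F (σ * g)) / C σ := by
        rw [Finset.sum_comm]
        refine Finset.sum_congr rfl fun σ _ => ?_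
        rw [← Finset.sum_filter, Finset.sum_div]
    _ ≤ ∑ _σ : Equiv.Perm X, b := by
        refine Finset.sum_le_sum fun σ _ => ?_
        rw [div_le_iff₀ (hCpos σ), ← hsum]
        exact hF σ
    _ = _ := by rw [Finset.sum_const, Finset.card_univ, nsmul_eq_mul, mul_comm]

/-- The ratio of falling factorials `N⁽ᵉ⁾ / (N - t)⁽ᵉ⁾` is at most `D / (D - e t)`. -/
lemma sub_mul_descFactorial_le {N t : ℕ} {D : ℝ} (hD : 0 ≤ D) :
    ∀ e : ℕ, t + e ≤ N → D ≤ (N : ℝ) - e →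
      (D - e * t) * (N.descFactorial e : ℝ) ≤ D * ((N - t).descFactorial e : ℝ)
  | 0, _, _ => by simp
  | e + 1, h, hDe => by
    push_cast at hDe
    have ih := sub_mul_descFactorial_le (N := N) (t := t) hD e (by omega) (by linarith)
    rw [Nat.descFactorial_succ, Nat.descFactorial_succ]
    have e1 : ((N - t - e : ℕ) : ℝ) = N - t - e := by
      rw [Nat.cast_sub (by omega), Nat.cast_sub (by omega)]
    have e2 : ((N - e : ℕ) : ℝ) = N - e := by rw [Nat.cast_sub (by omega)]
    push_cast
    rw [e1, e2]
    have hN : (0 : ℝ) ≤ N - t - e := by rw [← e1]; positivity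
    have h1 := mul_le_mul_of_nonneg_left ih hN
    have hX : (0 : ℝ) ≤ N.descFactorial e := by positivity
    -- The right side equals `(N - t - e) * (D - e * t) - (D - (e + 1) * t) * (N - e)`, the slack
    -- left by the induction hypothesis.
    have h2 : (0 : ℝ) ≤ t * (N - e - D + e * t) :=
      mul_nonneg (by positivity) (add_nonneg (by linarith) (by positivity))
    nlinarith [mul_nonneg h2 hX]

/-- The numerical estimates on the loss that is caused by `t` known points of the permutation. -/
lemma exists_ratio_bound {N T t e : ℕ} (hT : T ^ 2 < N) (hte : t + e ≤ T) :
    ∃ R : ℝ, 0 ≤ R ∧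
      (N.descFactorial e : ℝ) * (N - t - e).factorial ≤ R * (N - t).factorial ∧
      (∀ θ : ℝ, 0 ≤ θ → θ ≤ 1 → (t * e : ℝ) + 7 / 4 * (θ * R) ≤ (T : ℝ) ^ 2 + 2 * θ) ∧
      (1 ≤ T → ∀ θ : ℝ, 0 ≤ θ → θ ≤ 1 → (t * e : ℝ) + θ * R ≤ (T : ℝ) ^ 2) := by
  have hTN : T < N := by nlinarith
  have hNT : (T : ℝ) + 1 ≤ N := by exact_mod_cast hTN
  have hTe : (t : ℝ) + e ≤ T := by exact_mod_cast hte
  have ht0 : (0 : ℝ) ≤ t := by positivity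
  have he0 : (0 : ℝ) ≤ e := by positivity
  have key := sub_mul_descFactorial_le (N := N) (t := t) (D := (N : ℝ) - T) (by linarith) e
    (by omega) (by linarith)
  have hfac : ((N - t - e).factorial : ℝ) * (N - t).descFactorial e = (N - t).factorial := by
    exact_mod_cast Nat.factorial_mul_descFactorial (by omega : e ≤ N - t)
  have hF : (0 : ℝ) < (N - t - e).factorial := by exact_mod_cast Nat.factorial_pos _
  have hX : (0 : ℝ) ≤ N.descFactorial e := by positivity
  have hT2 : (T : ℝ) ^ 2 + 1 ≤ N := by exact_mod_cast hT
  have hred : ∀ R : ℝ, (N.descFactorial e : ℝ) ≤ R * (N - t).descFactorial e →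
      (N.descFactorial e : ℝ) * (N - t - e).factorial ≤ R * (N - t).factorial := fun R h => by
    rw [← hfac]
    nlinarith
  -- Without conceded keys there is no loss and `R = 1`. Otherwise `T ≥ 2` and `t * e ≤ T ^ 2 / 4`,
  -- which leaves room for `R = 2`.
  by_cases h0 : t * e = 0
  · have h0' : (t * e : ℝ) = 0 := by exact_mod_cast h0
    refine ⟨1, by norm_num, hred 1 ?_, ?_, ?_⟩
    · have : (e * t : ℝ) = 0 := by rw [mul_comm]; exact h0'
      rw [this, sub_zero] at key
      rw [one_mul]
      exact le_of_mul_le_mul_left key (by linarith)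
    · intro θ hθ _
      rw [h0']; nlinarith [sq_nonneg (T : ℝ)]
    · intro hT1 θ _ hθ
      have : (1 : ℝ) ≤ T := by exact_mod_cast hT1
      rw [h0']; nlinarith
  · have ht1 : 1 ≤ t := Nat.one_le_iff_ne_zero.2 fun h => h0 (by simp [h])
    have he1 : 1 ≤ e := Nat.one_le_iff_ne_zero.2 fun h => h0 (by simp [h])
    have hT2' : (2 : ℝ) ≤ T := by exact_mod_cast (by omega : 2 ≤ T)
    have hamgm : (t * e : ℝ) ≤ (T : ℝ) ^ 2 / 4 := by
      nlinarith [sq_nonneg ((t : ℝ) - e)]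
    refine ⟨2, by norm_num, hred 2 ?_, ?_, ?_⟩
    · have h1 : ((N : ℝ) - T) / 2 ≤ (N : ℝ) - T - e * t := by
        nlinarith [sq_nonneg ((T : ℝ) - 1)]
      have h2 := (mul_le_mul_of_nonneg_right h1 hX).trans key
      have h3 : (0 : ℝ) < N - T := by linarith
      have : ((N : ℝ) - T) * (N.descFactorial e : ℝ) ≤
          ((N : ℝ) - T) * (2 * (N - t).descFactorial e) := by linarith
      exact le_of_mul_le_mul_left this h3
    · intro θ hθ hθ1
      nlinarith
    · intro _ θ hθ hθ1
      nlinarith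

end Counting

lemma exp_le_one_add {x : ℝ} (h0 : 0 ≤ x) (h1 : x ≤ 1) : Real.exp x ≤ 1 + 7 / 4 * x := by
  have := convexOn_exp.2 (Set.mem_univ (0 : ℝ)) (Set.mem_univ (1 : ℝ)) (sub_nonneg.2 h1) h0
    (by ring)
  simp only [smul_eq_mul, mul_zero, mul_one, zero_add, Real.exp_zero] at this
  nlinarith [Real.exp_one_lt_d9]

/-! ### A fixed attack, conditioned on its public answers -/

namespace EM

lemma card_block (n : ℕ) : Fintype.card (Block n) = 2 ^ n := by
  rw [Fintype.card_congr BitVec.equivFin.toEquiv, Fintype.card_fin]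

lemma xor_right_injective {n : ℕ} (a : Block n) : Function.Injective fun m => a ^^^ m := by
  intro m m' h
  have := congrArg (fun y => a ^^^ y) h
  simpa [← BitVec.xor_assoc] using this

lemma eq_xor_of_xor_eq {n : ℕ} {a m x : Block n} (h : x = a ^^^ m) : a = x ^^^ m := by
  rw [h, BitVec.xor_assoc, BitVec.xor_self, BitVec.xor_zero]

namespace Attack

variable {n : ℕ} {K : Type}

open Classical in
/-- The arguments at which the public queries reveal the permutation. -/
noncomputable def pubPts (B : Attack n K) (σ : Equiv.Perm (Block n)) : Finset (Block n) :=
  Finset.univ.filter fun x => Query.pub x ∈ B.queries ∨ Query.pubInv (σ x) ∈ B.queries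

open Classical in
/-- The queried plaintexts. -/
noncomputable def encPts (B : Attack n K) : Finset (Block n) :=
  Finset.univ.filter fun m => Query.enc m ∈ B.queries

open Classical in
lemma card_pubPts_add_card_encPts_le (B : Attack n K) (σ : Equiv.Perm (Block n)) :
    (B.pubPts σ).card + B.encPts.card ≤ B.queries.length := by
  refine le_trans ?_ (List.toFinset_card_le B.queries)
  rw [← Finset.card_disjSum]
  refine Finset.card_le_card_of_injOn (Sum.elim
    (fun x => if Query.pub x ∈ B.queries then Query.pub x else Query.pubInv (σ x)) Query.enc) ?_ ?_
  · rintro (x | m) h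
    · simp only [pubPts, Finset.mem_coe, Finset.inl_mem_disjSum, Finset.mem_filter,
        Finset.mem_univ, true_and] at h
      simp only [Sum.elim_inl, Finset.mem_coe, List.mem_toFinset]
      split_ifs with hx
      · exact hx
      · exact h.resolve_left hx
    · simpa [encPts] using h
  · rintro (x | m) _ (x' | m') _ h
    · simp only [Sum.elim_inl] at h
      split_ifs at h <;> simp_all
    · simp only [Sum.elim_inl, Sum.elim_inr] at h
      split_ifs at h
    · simp only [Sum.elim_inl, Sum.elim_inr] at h
      split_ifs at h
    · simpa using h

/-- The revealed set is determined by the revealed values, as `sum_perm_le_of_fiber` requires; a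
`pubInv` query that `σ * g` answers at `x` is answered by `σ` at `g x`, and `g` fixes that point. -/
lemma pubPts_mul (B : Attack n K) (σ g : Equiv.Perm (Block n))
    (h : ∀ x ∈ B.pubPts σ, g x = x) : B.pubPts (σ * g) = B.pubPts σ := by
  classical
  ext x
  have hmem : ∀ σ y, y ∈ B.pubPts σ ↔
      Query.pub y ∈ B.queries ∨ Query.pubInv (σ y) ∈ B.queries := fun σ y => by simp [pubPts]
  have hmem' : x ∈ B.pubPts (σ * g) ↔
      Query.pub x ∈ B.queries ∨ Query.pubInv (σ (g x)) ∈ B.queries := hmem (σ * g) x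
  rw [hmem']
  constructor
  · rintro (hx | hx)
    · exact (hmem σ x).2 (Or.inl hx)
    · have h1 : g x ∈ B.pubPts σ := (hmem σ _).2 (Or.inr hx)
      have h2 : g x = x := g.injective (h _ h1)
      rwa [h2] at h1
  · intro hx
    rw [h x hx]
    exact (hmem σ x).1 hx

/-- The permutations that the public queries cannot distinguish from `σ`. -/
noncomputable def resample (B : Attack n K) (σ : Equiv.Perm (Block n))
    (ρ : Equiv.Perm {x // x ∉ B.pubPts σ}) : Equiv.Perm (Block n) := by
  classical
  exact σ * Equiv.Perm.ofSubtype ρ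

lemma resample_apply_mem (B : Attack n K) (σ : Equiv.Perm (Block n))
    (ρ : Equiv.Perm {x // x ∉ B.pubPts σ}) {x : Block n} (hx : x ∈ B.pubPts σ) :
    B.resample σ ρ x = σ x := by
  simp [resample, Equiv.Perm.ofSubtype_apply_of_not_mem ρ (not_not.2 hx)]

lemma resample_apply_not_mem (B : Attack n K) (σ : Equiv.Perm (Block n))
    (ρ : Equiv.Perm {x // x ∉ B.pubPts σ}) {x : Block n} (hx : x ∉ B.pubPts σ) :
    B.resample σ ρ x = σ (ρ ⟨x, hx⟩) := by
  simp [resample, Equiv.Perm.ofSubtype_apply_of_mem ρ hx]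

/-- The output depends on the public answers and the ciphertexts only. -/
lemma run_resample_congr (B : Attack n K) (σ : Equiv.Perm (Block n))
    (ρ ρ' : Equiv.Perm {x // x ∉ B.pubPts σ}) (k k' : Block n × Block n)
    (h : ∀ m ∈ B.encPts, encrypt (B.resample σ ρ) k m = encrypt (B.resample σ ρ') k' m) :
    B.run (B.resample σ ρ) k = B.run (B.resample σ ρ') k' := by
  classical
  unfold run
  congr 1
  refine List.map_congr_left fun q hq => ?_
  cases q with
  | pub x =>
    have hx : x ∈ B.pubPts σ := by simp [pubPts, hq]
    simp only [answer, resample_apply_mem B σ _ hx]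
  | pubInv y =>
    have hx : σ.symm y ∈ B.pubPts σ := by simp [pubPts, hq]
    have : ∀ ρ, (B.resample σ ρ).symm y = σ.symm y := fun ρ => by
      rw [Equiv.symm_apply_eq, resample_apply_mem B σ ρ hx, Equiv.apply_symm_apply]
    simp only [answer, this]
  | enc m => exact h m (by simp [encPts, hq])

open Classical in
/-- The unrevealed arguments at which encryption with first key `a` evaluates the permutation. -/
noncomputable def touched (B : Attack n K) (σ : Equiv.Perm (Block n)) (a : Block n) :
    Finset {x // x ∉ B.pubPts σ} :=
  Finset.univ.filter fun v => ∃ m ∈ B.encPts, v.1 = a ^^^ m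

/-- Encryption with first key `a` avoids the revealed part of the permutation. -/
def Fresh (B : Attack n K) (σ : Equiv.Perm (Block n)) (a : Block n) : Prop :=
  ∀ m ∈ B.encPts, a ^^^ m ∉ B.pubPts σ

lemma card_touched (B : Attack n K) {σ : Equiv.Perm (Block n)} {a : Block n}
    (ha : B.Fresh σ a) : (B.touched σ a).card = B.encPts.card := by
  classical
  symm
  refine Finset.card_bij (fun m hm => ⟨a ^^^ m, ha m hm⟩) ?_ ?_ ?_
  · intro m hm
    simp only [touched, Finset.mem_filter, Finset.mem_univ, true_and]
    exact ⟨m, hm, rfl⟩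
  · intro m _ m' _ h
    exact xor_right_injective a (congrArg Subtype.val h)
  · intro v hv
    simp only [touched, Finset.mem_filter, Finset.mem_univ, true_and] at hv
    obtain ⟨m, hm, h⟩ := hv
    exact ⟨m, hm, Subtype.ext h.symm⟩

open Classical in
lemma card_not_fresh_le (B : Attack n K) (σ : Equiv.Perm (Block n)) :
    (Finset.univ.filter fun a => ¬ B.Fresh σ a).card ≤ (B.pubPts σ).card * B.encPts.card := by
  rw [← Finset.card_product]
  refine le_trans (Finset.card_le_card ?_)
    (Finset.card_image_le (f := fun p : Block n × Block n => p.1 ^^^ p.2))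
  intro a ha
  simp only [Fresh, Finset.mem_filter, Finset.mem_univ, true_and, not_forall, not_not] at ha
  obtain ⟨m, hm, h⟩ := ha
  exact Finset.mem_image.2 ⟨(a ^^^ m, m), Finset.mem_product.2 ⟨h, hm⟩,
    (eq_xor_of_xor_eq rfl).symm⟩

-- A first key touches `v` only if it is `v ⊕ m` for a queried `m`, which leaves at most `e` keys
-- per point; a transposition moves two points.
open Classical in
lemma card_filter_swap_le (B : Attack n K) (σ : Equiv.Perm (Block n))
    {τ : Equiv.Perm {x // x ∉ B.pubPts σ}} (hτ : τ.IsSwap) :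
    (Finset.univ.filter fun a => τ ∉ fixingSubgroup (Equiv.Perm {x // x ∉ B.pubPts σ})
      (B.touched σ a : Set {x // x ∉ B.pubPts σ})).card ≤ 2 * B.encPts.card := by
  obtain ⟨x, y, -, rfl⟩ := hτ
  have hsub : (Finset.univ.filter fun a => Equiv.swap x y ∉
      fixingSubgroup (Equiv.Perm {x // x ∉ B.pubPts σ})
        (B.touched σ a : Set {x // x ∉ B.pubPts σ})) ⊆
      B.encPts.image (fun m => x.1 ^^^ m) ∪ B.encPts.image (fun m => y.1 ^^^ m) := by
    intro a ha
    simp only [Finset.mem_filter, Finset.mem_univ, true_and, mem_fixingSubgroup_iff, not_forall,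
      Finset.mem_coe, Equiv.Perm.smul_def] at ha
    obtain ⟨v, hv, hne⟩ := ha
    simp only [touched, Finset.mem_filter, Finset.mem_univ, true_and] at hv
    obtain ⟨m, hm, h⟩ := hv
    have : v = x ∨ v = y := by
      by_contra! hcon
      exact hne (Equiv.swap_apply_of_ne_of_ne hcon.1 hcon.2)
    rcases this with rfl | rfl
    · exact Finset.mem_union_left _ (Finset.mem_image.2 ⟨m, hm, (eq_xor_of_xor_eq h).symm⟩)
    · exact Finset.mem_union_right _ (Finset.mem_image.2 ⟨m, hm, (eq_xor_of_xor_eq h).symm⟩)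
  refine (Finset.card_le_card hsub).trans ((Finset.card_union_le _ _).trans ?_)
  rw [two_mul]
  exact add_le_add Finset.card_image_le Finset.card_image_le

variable [Fintype K] [DecidableEq K]

/-- The number of secrets that the attack recovers when the permutation is `σ`. -/
def hits (κ : K → Block n × Block n) (B : Attack n K) (σ : Equiv.Perm (Block n)) : ℕ :=
  (Finset.univ.filter fun k => B.run σ (κ k) = k).card

open Classical in
/-- The recovered secrets with first key `a`, provided that `a` is fresh. -/
noncomputable def freshHits (κ : K → Block n × Block n) (B : Attack n K)
    (σ : Equiv.Perm (Block n)) (a : Block n) (ρ : Equiv.Perm {x // x ∉ B.pubPts σ}) : ℕ :=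
  (Finset.univ.filter fun k => (κ k).1 = a ∧ B.Fresh σ a ∧ B.run (B.resample σ ρ) (κ k) = k).card

-- All `q` secrets over each non-fresh first key are counted as recovered.
open Classical in
lemma hits_le {κ : K → Block n × Block n} {q : ℕ}
    (hκ : ∀ a, (Finset.univ.filter fun k => (κ k).1 = a).card = q)
    (B : Attack n K) (σ : Equiv.Perm (Block n)) (ρ : Equiv.Perm {x // x ∉ B.pubPts σ}) :
    B.hits κ (B.resample σ ρ) ≤
      q * ((B.pubPts σ).card * B.encPts.card) + ∑ a, B.freshHits κ σ a ρ := by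
  have h1 : (Finset.univ.filter fun k => ¬ B.Fresh σ (κ k).1).card ≤
      q * ((B.pubPts σ).card * B.encPts.card) := by
    calc (Finset.univ.filter fun k => ¬ B.Fresh σ (κ k).1).card
        = ∑ a ∈ Finset.univ.filter (fun a => ¬ B.Fresh σ a),
          ((Finset.univ.filter fun k => ¬ B.Fresh σ (κ k).1).filter fun k => (κ k).1 = a).card :=
          Finset.card_eq_sum_card_fiberwise fun k hk => by simpa using hk
      _ ≤ ∑ a ∈ Finset.univ.filter (fun a => ¬ B.Fresh σ a), q := by
          refine Finset.sum_le_sum fun a _ => ?_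
          rw [← hκ a]
          exact Finset.card_le_card (Finset.filter_subset_filter _ (Finset.subset_univ _))
      _ ≤ _ := by
          rw [Finset.sum_const, smul_eq_mul, mul_comm]
          exact Nat.mul_le_mul_left _ (B.card_not_fresh_le σ)
  have h2 : (Finset.univ.filter fun k =>
      B.Fresh σ (κ k).1 ∧ B.run (B.resample σ ρ) (κ k) = k).card = ∑ a, B.freshHits κ σ a ρ := by
    rw [Finset.card_eq_sum_card_fiberwise (f := fun k => (κ k).1) (t := Finset.univ)
      fun k _ => by simp]
    refine Finset.sum_congr rfl fun a _ => ?_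
    unfold freshHits
    rw [Finset.filter_filter]
    congr 1
    ext k
    simp only [Finset.mem_filter, Finset.mem_univ, true_and]
    constructor
    · rintro ⟨⟨h1, h2⟩, rfl⟩; exact ⟨rfl, h1, h2⟩
    · rintro ⟨rfl, h1, h2⟩; exact ⟨⟨h1, h2⟩, rfl⟩
  rw [← h2]
  refine le_trans ?_ (add_le_add_left h1 _)
  refine (Finset.card_le_card ?_).trans (Finset.card_union_le _ _)
  intro k hk
  simp only [Finset.mem_filter, Finset.mem_univ, true_and, Finset.mem_union] at hk ⊢
  tauto

-- Group the successful pairs (secret, `ρ`) by their ciphertexts, an injective tuple of `e` blocks.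
-- The tuple determines the guess, hence the secret, hence `ρ` at the `e` touched points; the other
-- unrevealed points are free.
open Classical in
lemma sum_freshHits_le (κ : K → Block n × Block n) (B : Attack n K)
    (σ : Equiv.Perm (Block n)) :
    ∑ a, ∑ ρ, B.freshHits κ σ a ρ ≤ (2 ^ n).descFactorial B.encPts.card *
      (2 ^ n - (B.pubPts σ).card - B.encPts.card).factorial := by
  set V := {x // x ∉ B.pubPts σ}
  set W : Finset (K × Equiv.Perm V) := Finset.univ.filter fun p =>
    B.Fresh σ (κ p.1).1 ∧ B.run (B.resample σ p.2) (κ p.1) = p.1 with hW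
  have h1 : ∑ a, ∑ ρ, B.freshHits κ σ a ρ = W.card := by
    rw [Finset.sum_comm, Finset.card_eq_sum_card_fiberwise (f := Prod.snd) (t := Finset.univ)
      fun k _ => by simp]
    refine Finset.sum_congr rfl fun ρ _ => ?_
    rw [Finset.card_eq_sum_card_fiberwise (f := fun p : K × Equiv.Perm V => (κ p.1).1)
      (t := Finset.univ) fun k _ => by simp]
    refine Finset.sum_congr rfl fun a _ => ?_
    unfold freshHits
    refine Finset.card_bij (fun k _ => (k, ρ)) ?_ ?_ ?_
    · intro k hk
      simp only [Finset.mem_filter, Finset.mem_univ, true_and, hW] at hk ⊢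
      obtain ⟨rfl, h1, h2⟩ := hk
      exact ⟨⟨⟨h1, h2⟩, trivial⟩, rfl⟩
    · intro k _ k' _ h
      exact congrArg Prod.fst h
    · rintro ⟨k, ρ'⟩ hk
      simp only [Finset.mem_filter, Finset.mem_univ, true_and, hW] at hk
      obtain ⟨⟨⟨h1, h2⟩, rfl⟩, rfl⟩ := hk
      exact ⟨k, Finset.mem_filter.2 ⟨Finset.mem_univ _, rfl, h1, h2⟩, rfl⟩
  have hinj : ∀ p : K × Equiv.Perm V, Function.Injective fun m : B.encPts =>
      encrypt (B.resample σ p.2) (κ p.1) m := by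
    intro p m m' h
    exact Subtype.ext (xor_right_injective _ ((B.resample σ p.2).injective
      (xor_right_injective _ h)))
  set f : K × Equiv.Perm V → (B.encPts ↪ Block n) := fun p => ⟨_, hinj p⟩ with hf
  have hfib : ∀ c : B.encPts ↪ Block n, (W.filter fun p => f p = c).card ≤
      (2 ^ n - (B.pubPts σ).card - B.encPts.card).factorial := by
    intro c
    rcases (W.filter fun p => f p = c).eq_empty_or_nonempty with he | ⟨⟨k, ρ₀⟩, h0⟩
    · rw [he]; simp
    · have h0' := h0
      simp only [Finset.mem_filter, Finset.mem_univ, true_and, hW] at h0'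
      obtain ⟨⟨hfr, hrun⟩, hc⟩ := h0'
      have hcardV : Fintype.card V = 2 ^ n - (B.pubPts σ).card := by
        simp only [V]
        rw [Fintype.card_subtype_compl, Fintype.card_coe]
        rw [card_block]
      have := card_perm_eqOn_le (B.touched σ (κ k).1) ρ₀
      rw [B.card_touched hfr, hcardV] at this
      refine le_trans (Finset.card_le_card_of_injOn Prod.snd ?_ ?_) this
      all_goals
        have hall : ∀ p ∈ (W.filter fun p => f p = c), p.1 = k ∧ f p = f (k, ρ₀) := by
          rintro ⟨k', ρ⟩ hp
          simp only [Finset.mem_filter, Finset.mem_univ, true_and, hW] at hp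
          obtain ⟨⟨hfr', hrun'⟩, hc'⟩ := hp
          have heq : f (k', ρ) = f (k, ρ₀) := hc'.trans hc.symm
          refine ⟨?_, heq⟩
          rw [← hrun, ← hrun']
          exact B.run_resample_congr σ _ _ _ _ fun m hm =>
            congrArg (fun g : B.encPts ↪ Block n => g ⟨m, hm⟩) heq
      · rintro ⟨k', ρ⟩ hp
        obtain ⟨hk, heq⟩ := hall _ hp
        simp only at hk
        subst hk
        simp only [Finset.coe_filter, Finset.mem_univ, true_and, Set.mem_ofPred_eq]
        intro v hv
        simp only [touched, Finset.mem_filter, Finset.mem_univ, true_and] at hv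
        obtain ⟨m, hm, h⟩ := hv
        have h2 := congrArg (fun g : B.encPts ↪ Block n => g ⟨m, hm⟩) heq
        have h3 := xor_right_injective _ h2
        simp only at h3
        rw [← h, resample_apply_not_mem B σ _ v.2, resample_apply_not_mem B σ _ v.2] at h3
        exact Subtype.ext (σ.injective h3)
      · rintro ⟨k₁, ρ₁⟩ h₁ ⟨k₂, ρ₂⟩ h₂ h
        exact Prod.ext ((hall _ h₁).1.trans (hall _ h₂).1.symm) h
  rw [h1, Finset.card_eq_sum_card_fiberwise (f := f) (t := Finset.univ) fun k _ => by simp]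
  refine (Finset.sum_le_sum fun c _ => hfib c).trans (le_of_eq ?_)
  rw [Finset.sum_const, Finset.card_univ, Fintype.card_embedding_eq, smul_eq_mul]
  rw [card_block, Fintype.card_coe]

end Attack

end EM

/-! ### Mean and exponential moment of the number of recovered secrets -/

namespace EM

namespace Attack

variable {n : ℕ} {K : Type} [Fintype K] [DecidableEq K]

omit [Fintype K] [DecidableEq K] in
lemma resample_eq (B : Attack n K) (σ : Equiv.Perm (Block n))
    (ρ : Equiv.Perm {x // x ∉ B.pubPts σ}) [DecidablePred fun x => x ∉ B.pubPts σ] :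
    B.resample σ ρ = σ * Equiv.Perm.ofSubtype ρ := by
  unfold resample
  congr!

omit [Fintype K] [DecidableEq K] in
lemma card_perm_not_pubPts (B : Attack n K) (σ : Equiv.Perm (Block n)) :
    Fintype.card (Equiv.Perm {x // x ∉ B.pubPts σ}) = (2 ^ n - (B.pubPts σ).card).factorial := by
  classical
  rw [Fintype.card_perm, Fintype.card_subtype_compl, Fintype.card_coe, card_block]

omit [Fintype K] [DecidableEq K] in
lemma sum_le_of_resample (B : Attack n K) (F : Equiv.Perm (Block n) → ℝ) (b : ℝ)
    (hF : ∀ σ, ∑ ρ, F (B.resample σ ρ) ≤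
      b * Fintype.card (Equiv.Perm {x // x ∉ B.pubPts σ})) :
    ∑ σ, F σ ≤ b * Fintype.card (Equiv.Perm (Block n)) := by
  classical
  have := sum_perm_le_of_fiber B.pubPts B.pubPts_mul F b (fun σ => by
    have := hF σ
    simp only [resample_eq] at this
    convert this)
  convert this

open Classical in
lemma sum_resample_hits_le {κ : K → Block n × Block n} {q : ℕ}
    (hκ : ∀ a, (Finset.univ.filter fun k => (κ k).1 = a).card = q) (hq : 1 ≤ q)
    {T : ℕ} (hT : 1 ≤ T) (hTN : T ^ 2 < 2 ^ n) (B : Attack n K) (hB : B.queries.length ≤ T)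
    (σ : Equiv.Perm (Block n)) :
    ∑ ρ, (B.hits κ (B.resample σ ρ) : ℝ) ≤
      q * (T : ℝ) ^ 2 * Fintype.card (Equiv.Perm {x // x ∉ B.pubPts σ}) := by
  obtain ⟨R, -, hR, -, hmean⟩ :=
    exists_ratio_bound hTN ((B.card_pubPts_add_card_encPts_le σ).trans hB)
  have hq' : (1 : ℝ) ≤ q := by exact_mod_cast hq
  -- Hits are measured in units of `q`, the number of secrets per first key, so the fresh term
  -- carries the factor `θ = 1 / q`.
  have hb := hmean hT ((q : ℝ)⁻¹) (by positivity) (inv_le_one_of_one_le₀ hq')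
  have hfresh : (∑ a, ∑ ρ, (B.freshHits κ σ a ρ : ℝ)) ≤
      R * Fintype.card (Equiv.Perm {x // x ∉ B.pubPts σ}) := by
    rw [B.card_perm_not_pubPts σ]
    refine le_trans ?_ hR
    exact_mod_cast B.sum_freshHits_le κ σ
  calc ∑ ρ, (B.hits κ (B.resample σ ρ) : ℝ)
      ≤ ∑ ρ, (q * ((B.pubPts σ).card * B.encPts.card : ℝ) + ∑ a, (B.freshHits κ σ a ρ : ℝ)) :=
        Finset.sum_le_sum fun ρ _ => by exact_mod_cast B.hits_le hκ σ ρ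
    _ = q * ((B.pubPts σ).card * B.encPts.card : ℝ) *
          Fintype.card (Equiv.Perm {x // x ∉ B.pubPts σ}) +
          ∑ a, ∑ ρ, (B.freshHits κ σ a ρ : ℝ) := by
        rw [Finset.sum_add_distrib, Finset.sum_comm, Finset.sum_const, Finset.card_univ,
          nsmul_eq_mul, mul_comm]
    _ ≤ q * ((B.pubPts σ).card * B.encPts.card : ℝ) *
          Fintype.card (Equiv.Perm {x // x ∉ B.pubPts σ}) +
          q * ((q : ℝ)⁻¹ * R) * Fintype.card (Equiv.Perm {x // x ∉ B.pubPts σ}) := by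
        rw [mul_inv_cancel_left₀ (by linarith)]
        linarith
    _ = q * ((B.pubPts σ).card * B.encPts.card + (q : ℝ)⁻¹ * R) *
          Fintype.card (Equiv.Perm {x // x ∉ B.pubPts σ}) := by ring
    _ ≤ _ := by gcongr

open Classical in
lemma freshHits_mul_of_mem {κ : K → Block n × Block n} (B : Attack n K)
    (σ : Equiv.Perm (Block n)) (a : Block n) (ρ g : Equiv.Perm {x // x ∉ B.pubPts σ})
    (hg : g ∈ fixingSubgroup (Equiv.Perm {x // x ∉ B.pubPts σ})
      (B.touched σ a : Set {x // x ∉ B.pubPts σ})) :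
    B.freshHits κ σ a (ρ * g) = B.freshHits κ σ a ρ := by
  unfold freshHits
  congr 1
  refine Finset.filter_congr fun k _ => ?_
  refine and_congr_right fun hk => and_congr_right fun ha => ?_
  rw [B.run_resample_congr σ (ρ * g) ρ (κ k) (κ k) fun m hm => ?_]
  subst hk
  have hmem : (⟨(κ k).1 ^^^ m, ha m hm⟩ : {x // x ∉ B.pubPts σ}) ∈ B.touched σ (κ k).1 := by
    simp only [touched, Finset.mem_filter, Finset.mem_univ, true_and]
    exact ⟨m, hm, rfl⟩
  have hfix := (mem_fixingSubgroup_iff _).1 hg _ (Finset.mem_coe.2 hmem)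
  rw [Equiv.Perm.smul_def] at hfix
  unfold encrypt
  rw [resample_apply_not_mem B σ _ (ha m hm), resample_apply_not_mem B σ _ (ha m hm),
    Equiv.Perm.mul_apply, hfix]

open Classical in
lemma sum_resample_exp_hits_le {κ : K → Block n × Block n} {q : ℕ}
    (hκ : ∀ a, (Finset.univ.filter fun k => (κ k).1 = a).card = q) (hq : 1 ≤ q)
    {T : ℕ} (hTN : T ^ 2 < 2 ^ n) (B : Attack n K) (hB : B.queries.length ≤ T)
    (σ : Equiv.Perm (Block n)) :
    ∑ ρ, Real.exp ((B.hits κ (B.resample σ ρ) : ℝ) / (q * (2 * (T + 1)))) ≤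
      Real.exp (((T : ℝ) ^ 2 + 2 * (q : ℝ)⁻¹) / (2 * (T + 1))) *
        Fintype.card (Equiv.Perm {x // x ∉ B.pubPts σ}) := by
  have hlen := (B.card_pubPts_add_card_encPts_le σ).trans hB
  obtain ⟨R, -, hR, hexp, -⟩ := exists_ratio_bound hTN hlen
  have hq' : (1 : ℝ) ≤ q := by exact_mod_cast hq
  have hq0 : (0 : ℝ) < q := by linarith
  have hb := hexp ((q : ℝ)⁻¹) (by positivity) (inv_le_one_of_one_le₀ hq')
  set V := {x // x ∉ B.pubPts σ} with hV
  set M : ℝ := (Fintype.card (Equiv.Perm V) : ℝ) with hM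
  have hMpos : 0 < M := by rw [hM]; exact_mod_cast Fintype.card_pos
  have hfresh : (∑ a, ∑ ρ, (B.freshHits κ σ a ρ : ℝ)) ≤ R * M := by
    rw [hM, B.card_perm_not_pubPts σ]
    refine le_trans ?_ hR
    exact_mod_cast B.sum_freshHits_le κ σ
  -- Overlap at most `2 * e ≤ 2 * T` would do; the extra 1 keeps `c` positive when `T = 0`.
  set c : ℝ := 2 * (T + 1) with hc
  have hcpos : 0 < c := by positivity
  set h : Block n → Equiv.Perm V → ℝ := fun a ρ => (B.freshHits κ σ a ρ : ℝ) / q with hh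
  have hh0 : ∀ a ρ, 0 ≤ h a ρ := fun a ρ => by positivity
  have hh1 : ∀ a ρ, h a ρ ≤ 1 := fun a ρ => by
    simp only [hh]
    rw [div_le_one hq0, ← hκ a]
    exact_mod_cast Finset.card_le_card fun k hk => by
      simp only [Finset.mem_filter, Finset.mem_univ, true_and] at hk ⊢
      exact hk.1
  have hmain := log_avg_exp_sum_le (G := Equiv.Perm V) hcpos
    (H := fun a => fixingSubgroup (Equiv.Perm V) (B.touched σ a : Set V))
    (𝒯 := {τ | τ.IsSwap}) Equiv.Perm.closure_isSwap
    (by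
      intro τ hτ x
      have hτ' : (x⁻¹ * τ * x).IsSwap := by
        obtain ⟨u, v, huv, rfl⟩ := hτ
        refine ⟨x⁻¹ u, x⁻¹ v, fun h => huv (x⁻¹.injective h), ?_⟩
        have := Equiv.swap_apply_apply x⁻¹ u v
        rw [this, inv_inv]
      have h1 : (((Finset.univ.filter fun a => x⁻¹ * τ * x ∉
          fixingSubgroup (Equiv.Perm V) (B.touched σ a : Set V)).card : ℕ) : ℝ) ≤
          ((2 * B.encPts.card : ℕ) : ℝ) := Nat.cast_le.2 (B.card_filter_swap_le σ hτ')
      have h2 : (B.encPts.card : ℝ) ≤ T := by exact_mod_cast (by omega : B.encPts.card ≤ T)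
      push_cast at h1
      linarith)
    h (fun a ρ g hg => by simp only [hh, B.freshHits_mul_of_mem σ a ρ g hg])
  -- Since `h a` takes values in `[0, 1]`, the chord bound on `exp` followed by `log y ≤ y - 1`
  -- reduces the exponential moment to the mean.
  have hterm : ∀ a, Real.log ((∑ ρ, Real.exp (h a ρ)) / M) ≤ 7 / 4 * ((∑ ρ, h a ρ) / M) := by
    intro a
    have hle : (∑ ρ, Real.exp (h a ρ)) / M ≤ 1 + 7 / 4 * ((∑ ρ, h a ρ) / M) := by
      rw [div_le_iff₀ hMpos, add_mul, one_mul, mul_assoc, div_mul_cancel₀ _ hMpos.ne',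
        Finset.mul_sum]
      calc ∑ ρ, Real.exp (h a ρ) ≤ ∑ ρ, (1 + 7 / 4 * h a ρ) :=
            Finset.sum_le_sum fun ρ _ => exp_le_one_add (hh0 a ρ) (hh1 a ρ)
        _ = _ := by
            rw [Finset.sum_add_distrib, Finset.sum_const, Finset.card_univ, nsmul_eq_mul, mul_one]
    have hpos : 0 < (∑ ρ, Real.exp (h a ρ)) / M :=
      div_pos (Finset.sum_pos (fun _ _ => Real.exp_pos _) ⟨1, Finset.mem_univ _⟩) hMpos
    linarith [Real.log_le_sub_one_of_pos hpos]
  have hsum : ∑ a, 7 / 4 * ((∑ ρ, h a ρ) / M) ≤ 7 / 4 * ((q : ℝ)⁻¹ * R) := by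
    rw [← Finset.mul_sum, ← Finset.sum_div]
    refine mul_le_mul_of_nonneg_left ?_ (by norm_num)
    rw [div_le_iff₀ hMpos, mul_assoc]
    simp only [hh, ← Finset.sum_div]
    rw [div_eq_inv_mul]
    exact mul_le_mul_of_nonneg_left hfresh (by positivity)
  have hlog := hmain.trans ((Finset.sum_le_sum fun a _ => hterm a).trans hsum)
  have hZpos : 0 < (∑ ρ, Real.exp ((∑ a, h a ρ) / c)) / M :=
    div_pos (Finset.sum_pos (fun _ _ => Real.exp_pos _) ⟨1, Finset.mem_univ _⟩) hMpos
  have hZ : ∑ ρ, Real.exp ((∑ a, h a ρ) / c) ≤ Real.exp (7 / 4 * ((q : ℝ)⁻¹ * R) / c) * M := by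
    rw [← div_le_iff₀ hMpos, ← Real.log_le_iff_le_exp hZpos, le_div_iff₀ hcpos, mul_comm]
    exact hlog
  calc ∑ ρ, Real.exp ((B.hits κ (B.resample σ ρ) : ℝ) / (q * c))
      ≤ ∑ ρ, Real.exp (((B.pubPts σ).card * B.encPts.card : ℝ) / c) *
          Real.exp ((∑ a, h a ρ) / c) := by
        refine Finset.sum_le_sum fun ρ _ => ?_
        rw [← Real.exp_add, Real.exp_le_exp, ← add_div, ← div_div]
        refine div_le_div_of_nonneg_right ?_ hcpos.le
        rw [div_le_iff₀ hq0]
        simp only [hh]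
        rw [← Finset.sum_div, add_mul, div_mul_cancel₀ _ hq0.ne', mul_comm _ (q : ℝ)]
        exact_mod_cast B.hits_le hκ σ ρ
    _ ≤ Real.exp (((B.pubPts σ).card * B.encPts.card : ℝ) / c) *
          (Real.exp (7 / 4 * ((q : ℝ)⁻¹ * R) / c) * M) := by
        rw [← Finset.mul_sum]
        exact mul_le_mul_of_nonneg_left hZ (Real.exp_pos _).le
    _ ≤ _ := by
        rw [← mul_assoc, ← Real.exp_add, ← add_div]
        gcongr

open Classical in
lemma sum_hits_le {κ : K → Block n × Block n} {q : ℕ}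
    (hκ : ∀ a, (Finset.univ.filter fun k => (κ k).1 = a).card = q) (hq : 1 ≤ q)
    {T : ℕ} (hT : 1 ≤ T) (hTN : T ^ 2 < 2 ^ n) (B : Attack n K) (hB : B.queries.length ≤ T) :
    ∑ σ, (B.hits κ σ : ℝ) ≤ q * (T : ℝ) ^ 2 * Fintype.card (Equiv.Perm (Block n)) :=
  B.sum_le_of_resample _ _ fun σ => B.sum_resample_hits_le hκ hq hT hTN hB σ

open Classical in
lemma sum_exp_hits_le {κ : K → Block n × Block n} {q : ℕ}
    (hκ : ∀ a, (Finset.univ.filter fun k => (κ k).1 = a).card = q) (hq : 1 ≤ q)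
    {T : ℕ} (hTN : T ^ 2 < 2 ^ n) (B : Attack n K) (hB : B.queries.length ≤ T) :
    ∑ σ, Real.exp ((B.hits κ σ : ℝ) / (q * (2 * (T + 1)))) ≤
      Real.exp (((T : ℝ) ^ 2 + 2 * (q : ℝ)⁻¹) / (2 * (T + 1))) *
        Fintype.card (Equiv.Perm (Block n)) :=
  B.sum_le_of_resample (fun σ => Real.exp ((B.hits κ σ : ℝ) / (q * (2 * (T + 1))))) _
    fun σ => B.sum_resample_exp_hits_le hκ hq hTN hB σ

lemma success_eq (κ : K → Block n × Block n) (B : Attack n K) :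
    B.success κ = (∑ σ, (B.hits κ σ : ℝ)) /
      (Fintype.card (Equiv.Perm (Block n)) * Fintype.card K) := by
  unfold success
  rw [Fintype.card_prod, Nat.cast_mul]
  congr 1
  rw [Finset.card_filter, Fintype.sum_prod_type]
  push_cast
  refine Finset.sum_congr rfl fun σ _ => ?_
  unfold hits
  rw [Finset.card_filter]
  push_cast
  rfl

lemma success_le_one (κ : K → Block n × Block n) (B : Attack n K) : B.success κ ≤ 1 := by
  unfold success
  refine div_le_one_of_le₀ ?_ (by positivity)
  exact_mod_cast Finset.card_le_univ _

end Attack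

/-! ### Attacks without preprocessing -/

section MaxSuccess

variable {n : ℕ} {K : Type} [Fintype K] [DecidableEq K]

lemma bddAbove_success (κ : K → Block n × Block n) (T : ℕ) :
    BddAbove {p : ℝ | ∃ B : Attack n K, B.queries.length ≤ T ∧ p = B.success κ} :=
  ⟨1, by rintro p ⟨B, -, rfl⟩; exact B.success_le_one κ⟩

/-- A constant guess without queries is right for exactly one secret. -/
lemma inv_card_le_maxSuccess [Nonempty K] (κ : K → Block n × Block n) (T : ℕ) :
    (Fintype.card K : ℝ)⁻¹ ≤ maxSuccess κ T := by
  obtain ⟨k₀⟩ := ‹Nonempty K›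
  refine le_csSup (bddAbove_success κ T) ⟨⟨[], fun _ => k₀⟩, by simp, ?_⟩
  have h1 : ∀ σ, Attack.hits κ (⟨[], fun _ => k₀⟩ : Attack n K) σ = 1 := fun σ => by
    unfold Attack.hits Attack.run
    rw [Finset.card_eq_one]
    exact ⟨k₀, by ext k; simp [eq_comm]⟩
  have hN : (Fintype.card (Equiv.Perm (Block n)) : ℝ) ≠ 0 := by
    exact_mod_cast Fintype.card_ne_zero
  rw [Attack.success_eq]
  simp only [h1, Nat.cast_one, Finset.sum_const, Finset.card_univ, nsmul_eq_mul, mul_one]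
  field_simp

omit [DecidableEq K] in
open Classical in
lemma card_key_eq {κ : K → Block n × Block n} {q : ℕ}
    (hκ : ∀ a, (Finset.univ.filter fun k => (κ k).1 = a).card = q) :
    Fintype.card K = q * 2 ^ n := by
  rw [← Finset.card_univ, Finset.card_eq_sum_card_fiberwise (f := fun k => (κ k).1)
    (t := Finset.univ) fun k _ => by simp]
  simp only [hκ]
  rw [Finset.sum_const, Finset.card_univ, card_block, smul_eq_mul, mul_comm]

open Classical in
lemma maxSuccess_le {κ : K → Block n × Block n} {q : ℕ}
    (hκ : ∀ a, (Finset.univ.filter fun k => (κ k).1 = a).card = q) (hq : 1 ≤ q)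
    {T : ℕ} (hT : 1 ≤ T) : maxSuccess κ T ≤ (T : ℝ) ^ 2 / 2 ^ n := by
  have hN : (0 : ℝ) < 2 ^ n := by positivity
  refine Real.sSup_le ?_ (by positivity)
  rintro p ⟨B, hB, rfl⟩
  by_cases hTN : T ^ 2 < 2 ^ n
  · have hG : (0 : ℝ) < Fintype.card (Equiv.Perm (Block n)) := by
      exact_mod_cast Fintype.card_pos
    have hq0 : (0 : ℝ) < q := by exact_mod_cast hq
    rw [Attack.success_eq, card_key_eq hκ, div_le_div_iff₀ (by push_cast; positivity) hN]
    have := mul_le_mul_of_nonneg_right (B.sum_hits_le hκ hq hT hTN hB) hN.le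
    push_cast
    linarith
  · refine (B.success_le_one κ).trans ((one_le_div hN).2 ?_)
    exact_mod_cast not_lt.1 hTN

end MaxSuccess

/-! ### Advice strings and the preprocessing bound -/

/-- There are at most `2 ^ (S + 1) - 1 ≤ 4 ^ S` advice strings of at most `S` bits. -/
lemma card_le_of_length_le (s : Finset (List Bool)) {S : ℕ} (hs : ∀ z ∈ s, z.length ≤ S) :
    s.card ≤ 4 ^ S := by
  classical
  have hsub : s ⊆ (Finset.range (S + 1)).biUnion fun i =>
      (Finset.univ : Finset (Fin i → Bool)).image List.ofFn := by
    intro z hz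
    rw [Finset.mem_biUnion]
    exact ⟨z.length, Finset.mem_range.2 (Nat.lt_succ_of_le (hs z hz)),
      Finset.mem_image.2 ⟨z.get, Finset.mem_univ _, List.ofFn_get z⟩⟩
  have hcount : ∀ S : ℕ, ∑ i ∈ Finset.range (S + 1), 2 ^ i ≤ 4 ^ S := by
    intro S
    induction S with
    | zero => simp
    | succ S ih =>
      rw [Finset.sum_range_succ, pow_succ 2 S, pow_succ 4 S]
      have : 2 ^ S ≤ 4 ^ S := Nat.pow_le_pow_left (by norm_num) S
      omega
  refine (Finset.card_le_card hsub).trans (Finset.card_biUnion_le.trans (le_trans ?_ (hcount S)))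
  refine Finset.sum_le_sum fun i _ => Finset.card_image_le.trans (le_of_eq ?_)
  simp

namespace PreAttack

variable {n : ℕ} {K : Type} [Fintype K] [DecidableEq K]

lemma success_eq (κ : K → Block n × Block n) (A : PreAttack n K) :
    A.success κ = (∑ σ, ((A.online (A.advice σ)).hits κ σ : ℝ)) /
      (Fintype.card (Equiv.Perm (Block n)) * Fintype.card K) := by
  unfold success
  rw [Fintype.card_prod, Nat.cast_mul]
  congr 1
  rw [Finset.card_filter, Fintype.sum_prod_type]
  push_cast
  refine Finset.sum_congr rfl fun σ _ => ?_
  unfold Attack.hits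
  rw [Finset.card_filter]
  push_cast
  rfl

lemma success_le_one (κ : K → Block n × Block n) (A : PreAttack n K) : A.success κ ≤ 1 := by
  unfold success
  refine div_le_one_of_le₀ ?_ (by positivity)
  exact_mod_cast Finset.card_le_univ _

lemma success_nonneg (κ : K → Block n × Block n) (A : PreAttack n K) : 0 ≤ A.success κ := by
  unfold success
  positivity

open Classical in
lemma success_le {κ : K → Block n × Block n} {q : ℕ}
    (hκ : ∀ a, (Finset.univ.filter fun k => (κ k).1 = a).card = q) (hq : 1 ≤ q)
    {S T : ℕ} (A : PreAttack n K) (hA : A.IsST S T) :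
    A.success κ ≤ 2 * maxSuccess κ T + 4 * Real.log 2 * S * (T + 1) / (2 : ℝ) ^ n
      + (T : ℝ) ^ 2 / (2 : ℝ) ^ n := by
  have hN : (0 : ℝ) < 2 ^ n := by positivity
  have hq0 : (0 : ℝ) < q := by exact_mod_cast hq
  have hcardK : (Fintype.card K : ℝ) = q * 2 ^ n := by exact_mod_cast card_key_eq hκ
  have hKpos : (0 : ℝ) < Fintype.card K := by rw [hcardK]; positivity
  have : Nonempty K := Fintype.card_pos_iff.1 (by exact_mod_cast hKpos)
  have hmax := inv_card_le_maxSuccess κ T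
  have hmax0 : 0 ≤ maxSuccess κ T := le_trans (by positivity) hmax
  have hlog2 : 0 ≤ Real.log 2 := Real.log_nonneg (by norm_num)
  -- When `T ^ 2 ≥ N` the last term of the bound is already at least 1.
  by_cases hTN : T ^ 2 < 2 ^ n
  swap
  · have h1 : (1 : ℝ) ≤ (T : ℝ) ^ 2 / 2 ^ n :=
      (one_le_div hN).2 (by exact_mod_cast not_lt.1 hTN)
    have h2 : 0 ≤ 4 * Real.log 2 * S * (T + 1) / (2 : ℝ) ^ n := by positivity
    linarith [A.success_le_one κ]
  set G : ℝ := (Fintype.card (Equiv.Perm (Block n)) : ℝ) with hG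
  have hGpos : 0 < G := by rw [hG]; exact_mod_cast Fintype.card_pos
  set c : ℝ := 2 * (T + 1) with hc
  have hcpos : 0 < c := by positivity
  set f : Equiv.Perm (Block n) → ℝ := fun σ =>
    ((A.online (A.advice σ)).hits κ σ : ℝ) / (q * c) with hf
  set Z := Finset.univ.image A.advice with hZ
  have hZcard : (Z.card : ℝ) ≤ 4 ^ S := by
    exact_mod_cast card_le_of_length_le Z fun z hz => by
      obtain ⟨σ, -, rfl⟩ := Finset.mem_image.1 hz
      exact (hA σ).1
  set b : ℝ := ((T : ℝ) ^ 2 + 2 * (q : ℝ)⁻¹) / c with hb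
  have hexp : ∑ σ, Real.exp (f σ) ≤ 4 ^ S * (Real.exp b * G) := by
    calc ∑ σ, Real.exp (f σ)
        ≤ ∑ σ, ∑ z ∈ Z, Real.exp (((A.online z).hits κ σ : ℝ) / (q * c)) :=
          Finset.sum_le_sum fun σ _ => Finset.single_le_sum
            (f := fun z => Real.exp (((A.online z).hits κ σ : ℝ) / (q * c)))
            (fun z _ => (Real.exp_pos _).le) (Finset.mem_image_of_mem _ (Finset.mem_univ σ))
      _ = ∑ z ∈ Z, ∑ σ, Real.exp (((A.online z).hits κ σ : ℝ) / (q * c)) := Finset.sum_comm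
      _ ≤ ∑ _z ∈ Z, Real.exp b * G := Finset.sum_le_sum fun z hz => by
          obtain ⟨σ, -, rfl⟩ := Finset.mem_image.1 hz
          exact (A.online (A.advice σ)).sum_exp_hits_le hκ hq hTN (hA σ).2
      _ ≤ _ := by
          rw [Finset.sum_const, nsmul_eq_mul]
          exact mul_le_mul_of_nonneg_right hZcard (by positivity)
  have hjensen : Real.exp ((∑ σ, f σ) / G) ≤ (∑ σ, Real.exp (f σ)) / G := by
    have := convexOn_exp.map_sum_le (t := Finset.univ)
      (w := fun _ : Equiv.Perm (Block n) => G⁻¹) (p := f) (fun _ _ => by positivity)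
      (by rw [Finset.sum_const, Finset.card_univ, nsmul_eq_mul, ← hG, mul_inv_cancel₀ hGpos.ne'])
      (fun _ _ => Set.mem_univ _)
    simp only [smul_eq_mul, ← Finset.mul_sum] at this
    rwa [← div_eq_inv_mul, ← div_eq_inv_mul] at this
  have hle : Real.exp ((∑ σ, f σ) / G) ≤ Real.exp (S * (2 * Real.log 2) + b) := by
    refine hjensen.trans ?_
    -- The bound `4 ^ S` costs `2 * log 2` per bit and leaves no additive constant, so that `S = 0`
    -- costs nothing.
    have h4 : Real.exp (S * (2 * Real.log 2)) = 4 ^ S := by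
      rw [Real.exp_nat_mul, two_mul, Real.exp_add, Real.exp_log (by norm_num)]
      norm_num
    rw [Real.exp_add, h4, div_le_iff₀ hGpos, mul_assoc]
    exact hexp
  have hsum := Real.exp_le_exp.1 hle
  have hsucc : A.success κ = (∑ σ, f σ) / G * (c / 2 ^ n) := by
    rw [success_eq, hcardK, ← hG]
    simp only [hf]
    rw [← Finset.sum_div]
    field_simp
  rw [hsucc]
  -- The summand `2 / q` in `b` becomes `2 / (q * N) = 2 / |K|`, which is at most `2 * maxSuccess κ
  -- T`.
  calc (∑ σ, f σ) / G * (c / 2 ^ n) ≤ (S * (2 * Real.log 2) + b) * (c / 2 ^ n) :=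
        mul_le_mul_of_nonneg_right hsum (by positivity)
    _ = 2 * (Fintype.card K : ℝ)⁻¹ + 4 * Real.log 2 * S * (T + 1) / (2 : ℝ) ^ n
          + (T : ℝ) ^ 2 / (2 : ℝ) ^ n := by
        rw [hcardK, hb]
        field_simp
        rw [hc]
        ring
    _ ≤ _ := by linarith

end PreAttack

/-! ### Shared random coins and the two key schedules -/

section Randomized

variable {n : ℕ} {K : Type} [Fintype K] [DecidableEq K]

lemma randSuccess_le {R : Type*} (ρ : PMF R) (κ : K → Block n × Block n)
    (A : R → PreAttack n K) {b : ℝ} (h : ∀ r, (A r).success κ ≤ b) :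
    randSuccess ρ κ A ≤ b := by
  have hsum : Summable fun r => (ρ r).toReal := ENNReal.summable_toReal ρ.tsum_coe_ne_top
  have hone : ∑' r, (ρ r).toReal = 1 := by
    rw [← ENNReal.tsum_toReal_eq fun r => ρ.apply_ne_top r, ρ.tsum_coe, ENNReal.toReal_one]
  calc randSuccess ρ κ A ≤ ∑' r, (ρ r).toReal * b := by
        refine Summable.tsum_le_tsum
          (fun r => mul_le_mul_of_nonneg_left (h r) ENNReal.toReal_nonneg)
          (Summable.of_nonneg_of_le
            (fun r => mul_nonneg ENNReal.toReal_nonneg ((A r).success_nonneg κ))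
            (fun r => mul_le_of_le_one_right ENNReal.toReal_nonneg ((A r).success_le_one κ)) hsum)
          (hsum.mul_right b)
    _ = b := by rw [tsum_mul_right, hone, one_mul]

open Classical in
/-- The bounds for every key schedule whose first key is uniformly distributed. -/
theorem preprocessing_bounds {κ : K → Block n × Block n} {q : ℕ}
    (hκ : ∀ a, (Finset.univ.filter fun k => (κ k).1 = a).card = q) (hq : 1 ≤ q) (S T : ℕ)
    {R : Type*} (ρ : PMF R) :
    (∀ A : R → PreAttack n K, (∀ r, (A r).IsST S T) →
        randSuccess ρ κ A ≤
          2 * maxSuccess κ T + 4 * Real.log 2 * S * (T + 1) / (2 : ℝ) ^ n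
            + (T : ℝ) ^ 2 / (2 : ℝ) ^ n) ∧
      (1 ≤ T →
        2 * maxSuccess κ T + 4 * Real.log 2 * S * (T + 1) / (2 : ℝ) ^ n
            + (T : ℝ) ^ 2 / (2 : ℝ) ^ n ≤
          3 * (T : ℝ) ^ 2 / (2 : ℝ) ^ n + 4 * Real.log 2 * S * (T + 1) / (2 : ℝ) ^ n) := by
  refine ⟨fun A hA => randSuccess_le ρ κ A fun r => (A r).success_le hκ hq (hA r), fun hT => ?_⟩
  have := maxSuccess_le hκ hq hT
  rw [mul_div_assoc 3]
  linarith

end Randomized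

open Classical in
lemma card_twoKey_fiber (n : ℕ) (a : Block n) :
    (Finset.univ.filter fun k => (twoKey n k).1 = a).card = 2 ^ n := by
  rw [← card_block n, ← Finset.card_univ]
  symm
  refine Finset.card_bij (fun b _ => (a, b)) (fun b _ => Finset.mem_filter.2 ⟨Finset.mem_univ _, rfl⟩)
    (fun b _ b' _ h => congrArg Prod.snd h) ?_
  rintro ⟨a', b⟩ h
  have ha : a' = a := (Finset.mem_filter.1 h).2
  exact ⟨b, Finset.mem_univ _, by rw [ha]⟩

open Classical in
lemma card_oneKey_fiber (n : ℕ) (a : Block n) :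
    (Finset.univ.filter fun k => (oneKey n k).1 = a).card = 1 := by
  rw [Finset.card_eq_one]
  exact ⟨a, by ext k; rw [Finset.mem_filter, Finset.mem_singleton]; simp [oneKey]⟩

end EM

theorem theorem3 (n S T : ℕ) {R : Type*} (ρ : PMF R) :
    -- the two-key cipher
    ((∀ A : R → EM.PreAttack n (EM.Block n × EM.Block n), (∀ r, (A r).IsST S T) →
        EM.randSuccess ρ (EM.twoKey n) A ≤
          2 * EM.maxSuccess (EM.twoKey n) T
            + 4 * Real.log 2 * S * (T + 1) / (2 : ℝ) ^ n + (T : ℝ) ^ 2 / (2 : ℝ) ^ n) ∧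
      (1 ≤ T →
        2 * EM.maxSuccess (EM.twoKey n) T
            + 4 * Real.log 2 * S * (T + 1) / (2 : ℝ) ^ n + (T : ℝ) ^ 2 / (2 : ℝ) ^ n ≤
          3 * (T : ℝ) ^ 2 / (2 : ℝ) ^ n + 4 * Real.log 2 * S * (T + 1) / (2 : ℝ) ^ n)) ∧
    -- the single-key cipher
    ((∀ A : R → EM.PreAttack n (EM.Block n), (∀ r, (A r).IsST S T) →
        EM.randSuccess ρ (EM.oneKey n) A ≤
          2 * EM.maxSuccess (EM.oneKey n) T
            + 4 * Real.log 2 * S * (T + 1) / (2 : ℝ) ^ n + (T : ℝ) ^ 2 / (2 : ℝ) ^ n) ∧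
      (1 ≤ T →
        2 * EM.maxSuccess (EM.oneKey n) T
            + 4 * Real.log 2 * S * (T + 1) / (2 : ℝ) ^ n + (T : ℝ) ^ 2 / (2 : ℝ) ^ n ≤
          3 * (T : ℝ) ^ 2 / (2 : ℝ) ^ n + 4 * Real.log 2 * S * (T + 1) / (2 : ℝ) ^ n)) := by
  exact ⟨EM.preprocessing_bounds (EM.card_twoKey_fiber n) Nat.one_le_two_pow S T ρ,
    EM.preprocessing_bounds (EM.card_oneKey_fiber n) le_rfl S T ρ⟩
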